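/- Let $\Bbbk$ be an algebraically closed field of characteristic $p>2$, and let $Y_n$ be the Yangian of $\mathfrak{gl}_n$ over $\Bbbk$: the associative algebra generated by $t_{i,j}^{(r)}$ ($1\le i,j\le n$, $r>0$) subject to $$[t_{i,j}^{(r)},t_{k,l}^{(s)}]=\sum_{t=0}^{\min(r,s)-1}\bigl(t_{k,j}^{(t)}t_{i,l}^{(r+s-1-t)}-t_{k,j}^{(r+s-1-t)}t_{i,l}^{(t)}\bigr)\qquad(r,s>0),$$ where $t_{i,j}^{(0)}:=\delta_{i,j}$. Put $t_{i,j}(u)=\sum_{r\ge 0}t_{i,j}^{(r)}u^{-r}\in Y_n[[u^{-1}]]$ and $T(u)=(t_{i,j}(u))_{1\le i,j\le n}$. For a composition $\mu=(\mu_1,\dots,\mu_m)$ of $n$ (with positive parts), let $T(u)=F(u)D(u)E(u)$ be the unique factorization in which, for the block decomposition of shape $\mu$, $D(u)=\mathrm{diag}(D_1(u),\dots,D_m(u))$ is block diagonal with $D_a(u)=(D_{a;i,j}(u))_{1\le i,j\le\mu_a}$, and $F(u)$ (respectively $E(u)$) is block lower (respectively upper) triangular with identity diagonal blocks. For the composition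 $(1,\dots,1)$ write $d_1(u),\dots,d_n(u)$ for the resulting $1\times1$ diagonal blocks, and define $$c(u)=d_1(u)\,d_2(u-1)\cdots d_n(u-n+1)\in Y_n[[u^{-1}]].$$ Here and below, for an integer $h$, a series in $(u-h)^{-1}$ is re-expanded in powers of $u^{-1}$. For $1\le a\le m$ put $p_a(\mu)=\mu_1+\cdots+\mu_{a-1}$ and $$\operatorname{qdet}D_a(u)=\sum_{\sigma\in S_{\mu_a}}\operatorname{sgn}(\sigma)\,D_{a;\sigma(1),1}(u)\,D_{a;\sigma(2),2}(u-1)\cdots D_{a;\sigma(\mu_a),\mu_a}(u-\mu_a+1).$$ Then, for every composition $\mu$ of $n$, the following identity holds in $Y_n[[u^{-1}]]$: $$c(u)=\operatorname{qdet}D_1(u-p_1(\mu))\,\operatorname{qdet}D_2(u-p_2(\mu))\cdots\operatorname{qdet}D_m(u-p_m(\mu)).$$ -/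

import Mathlib

open scoped PowerSeries

namespace ModularYangian

noncomputable section

/-! ## The Yangian in its RTT presentation -/

section RTT

variable (k : Type*) [CommRing k] (n : ℕ)

/-- The elements `t_{i,j}^{(r)}`, `r ≥ 0`, of the free algebra on the symbols `t_{i,j}^{(r)}`, `r > 0`.
The free generator `(i, j, r)` is `t_{i,j}^{(r+1)}`, and `t_{i,j}^{(0)} = δ_{i,j}` by convention. -/
def freeT (i j : Fin n) : ℕ → FreeAlgebra k (Fin n × Fin n × ℕ)
  | 0 => if i = j then 1 else 0
  | r + 1 => FreeAlgebra.ι k (i, j, r)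

/-- The RTT relations: for `r, s > 0`, `[t_{i,j}^{(r)}, t_{h,l}^{(s)}]` is equal to
`∑_{0 ≤ t < min(r,s)} (t_{h,j}^{(t)} t_{i,l}^{(r+s-1-t)} - t_{h,j}^{(r+s-1-t)} t_{i,l}^{(t)})`. -/
inductive RTTRel :
    FreeAlgebra k (Fin n × Fin n × ℕ) → FreeAlgebra k (Fin n × Fin n × ℕ) → Prop
  | rtt (i j h l : Fin n) (r s : ℕ) (hr : 0 < r) (hs : 0 < s) :
      RTTRel
        (freeT k n i j r * freeT k n h l s - freeT k n h l s * freeT k n i j r)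
        (∑ t ∈ Finset.range (min r s),
          (freeT k n h j t * freeT k n i l (r + s - 1 - t)
            - freeT k n h j (r + s - 1 - t) * freeT k n i l t))

/-- The Yangian `Y_n` over `k`. -/
abbrev Yangian : Type _ := RingQuot (RTTRel k n)

/-- The element `t_{i,j}^{(r)}` of `Y_n`, `r ≥ 0`. -/
def tGen (i j : Fin n) (r : ℕ) : Yangian k n :=
  RingQuot.mkAlgHom k (RTTRel k n) (freeT k n i j r)

/-- The matrix `T(u)`, with entries `t_{i,j}(u) = ∑_{r ≥ 0} t_{i,j}^{(r)} u^{-r}`.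
A series in `u⁻¹` is a power series whose variable `X` stands for `u⁻¹`. -/
def tMatrix : Matrix (Fin n) (Fin n) (Yangian k n)⟦X⟧ :=
  Matrix.of fun i j => PowerSeries.mk (tGen k n i j)

theorem tMatrix_constantCoeff : (tMatrix k n).map PowerSeries.constantCoeff = 1 := by
  ext i j
  by_cases h : i = j <;>
    simp [tMatrix, tGen, freeT, h, Matrix.one_apply, ← PowerSeries.coeff_zero_eq_constantCoeff_apply]

end RTT

/-! ## Block Gauss factorization -/

section Gauss

/-- `M = F D E` with `F` block lower unitriangular, `D` block diagonal and `E` block upper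
unitriangular, where `b i` is the block to which the index `i` belongs. -/
structure IsGaussFactorization {ι α A : Type*} [Fintype ι] [DecidableEq ι] [LinearOrder α] [Ring A]
    (b : ι → α) (M F D E : Matrix ι ι A) : Prop where
  eq_mul : M = F * D * E
  lower_eq_zero : ∀ i j, b i < b j → F i j = 0
  lower_diag : ∀ i j, b i = b j → F i j = (1 : Matrix ι ι A) i j
  diag_eq_zero : ∀ i j, b i ≠ b j → D i j = 0
  upper_eq_zero : ∀ i j, b j < b i → E i j = 0
  upper_diag : ∀ i j, b i = b j → E i j = (1 : Matrix ι ι A) i j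

variable {ι α R : Type*} [LinearOrder α] [Ring R]

/-- All entries of `M` are divisible by `X ^ k`. -/
def Vanishes (k : ℕ) (M : Matrix ι ι R⟦X⟧) : Prop :=
  ∀ i j r, r < k → PowerSeries.coeff r (M i j) = 0

theorem Vanishes.add {k : ℕ} {M N : Matrix ι ι R⟦X⟧} (hM : Vanishes k M) (hN : Vanishes k N) :
    Vanishes k (M + N) := fun i j r hr => by simp [hM i j r hr, hN i j r hr]

theorem Vanishes.sub {k : ℕ} {M N : Matrix ι ι R⟦X⟧} (hM : Vanishes k M) (hN : Vanishes k N) :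
    Vanishes k (M - N) := fun i j r hr => by simp [hM i j r hr, hN i j r hr]

theorem Vanishes.mono {k l : ℕ} (h : l ≤ k) {M : Matrix ι ι R⟦X⟧} (hM : Vanishes k M) :
    Vanishes l M := fun i j r hr => hM i j r (hr.trans_le h)

theorem Vanishes.mul [Fintype ι] {k l : ℕ} {M N : Matrix ι ι R⟦X⟧} (hM : Vanishes k M)
    (hN : Vanishes l N) : Vanishes (k + l) (M * N) := fun i j r hr => by
  rw [Matrix.mul_apply, map_sum]
  refine Finset.sum_eq_zero fun h _ => ?_
  rw [PowerSeries.coeff_mul]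
  refine Finset.sum_eq_zero fun x hx => ?_
  rw [Finset.HasAntidiagonal.mem_antidiagonal] at hx
  by_cases h1 : x.1 < k
  · rw [hM _ _ _ h1, zero_mul]
  · rw [hN _ _ _ (by omega), mul_zero]

theorem eq_of_vanishes {M N : Matrix ι ι R⟦X⟧} (h : ∀ k, Vanishes k (M - N)) : M = N := by
  ext i j r
  have := h (r + 1) i j r (Nat.lt_succ_self r)
  simpa [sub_eq_zero] using this

/-- The strictly lower block part. -/
def loPart {A : Type*} [Zero A] (b : ι → α) (M : Matrix ι ι A) : Matrix ι ι A :=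
  Matrix.of fun i j => if b j < b i then M i j else 0

/-- The block diagonal part. -/
def diPart {A : Type*} [Zero A] (b : ι → α) (M : Matrix ι ι A) : Matrix ι ι A :=
  Matrix.of fun i j => if b i = b j then M i j else 0

/-- The strictly upper block part. -/
def upPart {A : Type*} [Zero A] (b : ι → α) (M : Matrix ι ι A) : Matrix ι ι A :=
  Matrix.of fun i j => if b i < b j then M i j else 0

theorem parts_add (b : ι → α) (M : Matrix ι ι R) : loPart b M + diPart b M + upPart b M = M := by
  ext i j
  rcases lt_trichotomy (b i) (b j) with h | h | h
  · simp [loPart, diPart, upPart, h, h.ne, h.not_gt]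
  · simp [loPart, diPart, upPart, h]
  · simp [loPart, diPart, upPart, h, h.ne', h.not_gt]

theorem loPart_sub (b : ι → α) (M N : Matrix ι ι R) :
    loPart b (M - N) = loPart b M - loPart b N := by
  ext i j; by_cases h : b j < b i <;> simp [loPart, h]

theorem diPart_sub (b : ι → α) (M N : Matrix ι ι R) :
    diPart b (M - N) = diPart b M - diPart b N := by
  ext i j; by_cases h : b i = b j <;> simp [diPart, h]

theorem upPart_sub (b : ι → α) (M N : Matrix ι ι R) :
    upPart b (M - N) = upPart b M - upPart b N := by
  ext i j; by_cases h : b i < b j <;> simp [upPart, h]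

theorem Vanishes.loPart (b : ι → α) {k : ℕ} {M : Matrix ι ι R⟦X⟧} (hM : Vanishes k M) :
    Vanishes k (loPart b M) := fun i j r hr => by
  by_cases h : b j < b i <;> simp [ModularYangian.loPart, h, hM i j r hr]

theorem Vanishes.diPart (b : ι → α) {k : ℕ} {M : Matrix ι ι R⟦X⟧} (hM : Vanishes k M) :
    Vanishes k (diPart b M) := fun i j r hr => by
  by_cases h : b i = b j <;> simp [ModularYangian.diPart, h, hM i j r hr]

theorem Vanishes.upPart (b : ι → α) {k : ℕ} {M : Matrix ι ι R⟦X⟧} (hM : Vanishes k M) :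
    Vanishes k (upPart b M) := fun i j r hr => by
  by_cases h : b i < b j <;> simp [ModularYangian.upPart, h, hM i j r hr]

theorem vanishes_zero (k : ℕ) : Vanishes k (0 : Matrix ι ι R⟦X⟧) := fun i j r _ => by simp

theorem vanishes_sub_one [DecidableEq ι] {M : Matrix ι ι R⟦X⟧} (h : M.map PowerSeries.constantCoeff = 1) :
    Vanishes 1 (M - 1) := fun i j r hr => by
  obtain rfl : r = 0 := by omega
  have := congrFun (congrFun h i) j
  by_cases q : i = j
  · subst q; simpa [sub_eq_zero] using this
  · simpa [q, sub_eq_zero] using this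

variable [Fintype ι]

/-- The terms of `(1 + f) (1 + d) (1 + e)` of degree at least two in the three parts
`f, d, e` of `g`. -/
def crossTerms {A : Type*} [Ring A] (b : ι → α) (g : Matrix ι ι A) : Matrix ι ι A :=
  loPart b g * diPart b g + loPart b g * upPart b g + diPart b g * upPart b g
    + loPart b g * diPart b g * upPart b g

theorem vanishes_mul_sub {k : ℕ} {x y x' y' : Matrix ι ι R⟦X⟧} (hy : Vanishes 1 y)
    (hx' : Vanishes 1 x') (hx : Vanishes k (x - x')) (h : Vanishes k (y - y')) :
    Vanishes (k + 1) (x * y - x' * y') := by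
  have e : x * y - x' * y' = (x - x') * y + x' * (y - y') := by noncomm_ring
  rw [e]
  exact (hx.mul hy).add (by simpa [add_comm] using hx'.mul h)

theorem crossTerms_contract (b : ι → α) {k : ℕ} {g h : Matrix ι ι R⟦X⟧} (hg : Vanishes 1 g)
    (hh : Vanishes 1 h) (hd : Vanishes k (g - h)) :
    Vanishes (k + 1) (crossTerms b g - crossTerms b h) := by
  have l := hd.loPart b
  have d := hd.diPart b
  have u := hd.upPart b
  rw [loPart_sub] at l
  rw [diPart_sub] at d
  rw [upPart_sub] at u
  have h1 := vanishes_mul_sub (hg.diPart b) (hh.loPart b) l d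
  have h2 := vanishes_mul_sub (hg.upPart b) (hh.loPart b) l u
  have h3 := vanishes_mul_sub (hg.upPart b) (hh.diPart b) d u
  have h4 := vanishes_mul_sub (hg.upPart b)
    (((hh.loPart b).mul (hh.diPart b)).mono (by norm_num)) (h1.mono (Nat.le_succ k)) u
  have := ((h1.add h2).add h3).add h4
  convert this using 1
  unfold crossTerms
  abel

/-- Successive approximations to the solution of `g = N - crossTerms b g`. -/
def approx (b : ι → α) (N : Matrix ι ι R⟦X⟧) : ℕ → Matrix ι ι R⟦X⟧
  | 0 => 0
  | k + 1 => N - crossTerms b (approx b N k)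

theorem vanishes_one_crossTerms (b : ι → α) {g : Matrix ι ι R⟦X⟧} (hg : Vanishes 1 g) :
    Vanishes 1 (crossTerms b g) := by
  have h1 := (hg.loPart b).mul (hg.diPart b)
  exact (((h1.mono (by norm_num)).add
    (((hg.loPart b).mul (hg.upPart b)).mono (by norm_num))).add
    (((hg.diPart b).mul (hg.upPart b)).mono (by norm_num))).add
    ((h1.mul (hg.upPart b)).mono (by norm_num))

theorem approx_vanishes (b : ι → α) {N : Matrix ι ι R⟦X⟧} (hN : Vanishes 1 N) (k : ℕ) :
    Vanishes 1 (approx b N k) := by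
  induction k with
  | zero => exact vanishes_zero 1
  | succ k ih => exact hN.sub (vanishes_one_crossTerms b ih)

theorem approx_succ_sub (b : ι → α) {N : Matrix ι ι R⟦X⟧} (hN : Vanishes 1 N) (k : ℕ) :
    Vanishes k (approx b N (k + 1) - approx b N k) := by
  induction k with
  | zero => exact fun i j r hr => absurd hr (Nat.not_lt_zero r)
  | succ k ih =>
    have h := crossTerms_contract b (approx_vanishes b hN (k + 1)) (approx_vanishes b hN k) ih
    have e : approx b N (k + 1 + 1) - approx b N (k + 1)
        = 0 - (crossTerms b (approx b N (k + 1)) - crossTerms b (approx b N k)) := by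
      simp only [approx]; abel
    rw [e]
    exact (vanishes_zero _).sub h

theorem approx_coeff (b : ι → α) {N : Matrix ι ι R⟦X⟧} (hN : Vanishes 1 N) (i j : ι) (r m : ℕ) :
    PowerSeries.coeff r (approx b N (r + 1 + m) i j)
      = PowerSeries.coeff r (approx b N (r + 1) i j) := by
  induction m with
  | zero => rfl
  | succ m ih =>
    have h := approx_succ_sub b hN (r + 1 + m) i j r (by omega)
    rw [← ih]
    rw [Matrix.sub_apply, map_sub] at h
    exact sub_eq_zero.1 h

theorem exists_fixed (b : ι → α) {N : Matrix ι ι R⟦X⟧} (hN : Vanishes 1 N) :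
    ∃ g, Vanishes 1 g ∧ g = N - crossTerms b g := by
  let g : Matrix ι ι R⟦X⟧ := Matrix.of fun i j =>
    PowerSeries.mk fun r => PowerSeries.coeff r (approx b N (r + 1) i j)
  have hg1 : Vanishes 1 g := fun i j r hr => by
    simpa [g] using approx_vanishes b hN (r + 1) i j r hr
  have hg : ∀ k, Vanishes k (g - approx b N k) := fun k i j r hr => by
    obtain ⟨m, rfl⟩ := Nat.exists_eq_add_of_lt hr
    have := approx_coeff b hN i j r m
    rw [show r + m + 1 = r + 1 + m by omega]
    simp [g, this]
  refine ⟨g, hg1, eq_of_vanishes fun k => ?_⟩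
  have h1 := crossTerms_contract b (approx_vanishes b hN k) hg1
    (k := k) (by simpa using (vanishes_zero k).sub (hg k))
  have e : g - (N - crossTerms b g)
      = (g - approx b N (k + 1)) - (crossTerms b (approx b N k) - crossTerms b g) := by
    simp only [approx]; abel
  rw [e]
  exact ((hg (k + 1)).sub h1).mono (Nat.le_succ k)

theorem fixed_unique (b : ι → α) {N g h : Matrix ι ι R⟦X⟧} (hg : Vanishes 1 g) (hh : Vanishes 1 h)
    (eg : g = N - crossTerms b g) (eh : h = N - crossTerms b h) : g = h := by
  refine eq_of_vanishes fun k => ?_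
  induction k with
  | zero => exact fun i j r hr => absurd hr (Nat.not_lt_zero r)
  | succ k ih =>
    have h1 := crossTerms_contract b hg hh ih
    have e : g - h = 0 - (crossTerms b g - crossTerms b h) := by
      conv_lhs => rw [eg, eh]
      abel
    rw [e]
    exact (vanishes_zero _).sub h1

variable [DecidableEq ι]

/-- The only block factorization of the identity matrix is the trivial one. -/
theorem IsGaussFactorization.eq_one {b : ι → α} {F D E : Matrix ι ι R}
    (h : IsGaussFactorization b 1 F D E) : F = 1 ∧ D = 1 ∧ E = 1 := by
  set U := D * E with hU
  have hFU : F * U = 1 := by rw [hU, ← mul_assoc]; exact h.eq_mul.symm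
  have hUz : ∀ i j, b j < b i → U i j = 0 := fun i j hij => by
    rw [hU, Matrix.mul_apply]
    refine Finset.sum_eq_zero fun l _ => ?_
    by_cases hl : b i = b l
    · rw [h.upper_eq_zero l j (hl ▸ hij), mul_zero]
    · rw [h.diag_eq_zero i l hl, zero_mul]
  have key : ∀ s : Finset α, (∀ x ∈ s, ∀ y, (∃ i, b i = y) → y < x → y ∈ s) →
      ∀ i, b i ∈ s → (∀ j, U i j = (1 : Matrix ι ι R) i j) ∧
        (∀ j, F j i = (1 : Matrix ι ι R) j i) := by
    intro s
    induction s using Finset.induction_on_max with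
    | empty => simp
    | insert a s ha ih =>
      intro hs
      have ih' := ih (fun x hx y hy hyx => by
        rcases Finset.mem_insert.1 (hs x (Finset.mem_insert_of_mem hx) y hy hyx) with h | h
        · exact absurd (h ▸ hyx) (ha x hx).not_gt
        · exact h)
      have lt : ∀ l, b l < a → b l ∈ s := fun l hl => by
        rcases Finset.mem_insert.1 (hs a (Finset.mem_insert_self _ _) _ ⟨l, rfl⟩ hl) with h | h
        · exact absurd h hl.ne
        · exact h
      have rowU : ∀ i, b i = a → ∀ j, U i j = (1 : Matrix ι ι R) i j := fun i hi j => by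
        have e := congrFun (congrFun hFU i) j
        rw [Matrix.mul_apply, Finset.sum_eq_single i] at e
        · rwa [h.lower_diag i i rfl, Matrix.one_apply_eq, one_mul] at e
        · intro l _ hl
          rcases lt_trichotomy (b i) (b l) with q | q | q
          · rw [h.lower_eq_zero i l q, zero_mul]
          · rw [h.lower_diag i l q, Matrix.one_apply_ne hl.symm, zero_mul]
          · rw [(ih' l (lt l (hi ▸ q))).2 i, Matrix.one_apply_ne hl.symm, zero_mul]
        · simp
      have colF : ∀ i, b i = a → ∀ j, F j i = (1 : Matrix ι ι R) j i := fun i hi j => by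
        have e := congrFun (congrFun hFU j) i
        rw [Matrix.mul_apply, Finset.sum_eq_single i] at e
        · rwa [rowU i hi i, Matrix.one_apply_eq, mul_one] at e
        · intro l _ hl
          rcases lt_trichotomy (b i) (b l) with q | q | q
          · rw [hUz l i q, mul_zero]
          · rw [rowU l (q ▸ hi) i, Matrix.one_apply_ne hl, mul_zero]
          · rw [(ih' l (lt l (hi ▸ q))).1 i, Matrix.one_apply_ne hl, mul_zero]
        · simp
      intro i hi
      rcases Finset.mem_insert.1 hi with q | q
      · exact ⟨rowU i q, colF i q⟩
      · exact ih' i q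
  have all := key (Finset.univ.image b) (fun x _ y ⟨i, hi⟩ _ => by simp [← hi])
  have hF : F = 1 := by ext j i; exact (all i (by simp)).2 j
  have hU1 : U = 1 := by ext i j; exact (all i (by simp)).1 j
  have hD : D = 1 := by
    ext i j
    by_cases hij : b i = b j
    · have e := congrFun (congrFun hU1 i) j
      rw [hU, Matrix.mul_apply, Finset.sum_eq_single j] at e
      · rwa [h.upper_diag j j rfl, Matrix.one_apply_eq, mul_one] at e
      · intro l _ hl
        by_cases q : b i = b l
        · rw [h.upper_diag l j (q.symm.trans hij), Matrix.one_apply_ne hl, mul_zero]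
        · rw [h.diag_eq_zero i l q, zero_mul]
      · simp
    · rw [h.diag_eq_zero i j hij, Matrix.one_apply_ne (fun c => hij (congrArg b c))]
  refine ⟨hF, hD, ?_⟩
  rw [hU, hD, one_mul] at hU1
  exact hU1

theorem IsGaussFactorization.map {A B : Type*} [Ring A] [Ring B] (φ : A →+* B) {b : ι → α}
    {M F D E : Matrix ι ι A} (h : IsGaussFactorization b M F D E) :
    IsGaussFactorization b (M.map φ) (F.map φ) (D.map φ) (E.map φ) where
  eq_mul := by rw [h.eq_mul, Matrix.map_mul, Matrix.map_mul]
  lower_eq_zero i j q := by simp [h.lower_eq_zero i j q]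
  lower_diag i j q := by simp [h.lower_diag i j q, Matrix.one_apply, apply_ite φ]
  diag_eq_zero i j q := by simp [h.diag_eq_zero i j q]
  upper_eq_zero i j q := by simp [h.upper_eq_zero i j q]
  upper_diag i j q := by simp [h.upper_diag i j q, Matrix.one_apply, apply_ite φ]

theorem IsGaussFactorization.parts {A : Type*} [Ring A] {b : ι → α} {M F D E : Matrix ι ι A}
    (h : IsGaussFactorization b M F D E) :
    let g := (F - 1) + (D - 1) + (E - 1)
    loPart b g = F - 1 ∧ diPart b g = D - 1 ∧ upPart b g = E - 1 := by
  intro g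
  refine ⟨?_, ?_, ?_⟩ <;> ext i j <;> rcases lt_trichotomy (b i) (b j) with q | q | q
  all_goals
    first
    | have e1 := h.lower_eq_zero i j q
      have e2 := h.diag_eq_zero i j q.ne
      have e3 : i ≠ j := fun c => q.ne (c ▸ rfl)
      simp [loPart, diPart, upPart, g, q, q.ne, q.not_gt, e1, e2, e3]
    | have e1 := h.lower_diag i j q
      have e2 := h.upper_diag i j q
      simp [loPart, diPart, upPart, g, q, e1, e2]
    | have e1 := h.upper_eq_zero i j q
      have e2 := h.diag_eq_zero i j q.ne'
      have e3 : i ≠ j := fun c => q.ne (c ▸ rfl)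
      simp [loPart, diPart, upPart, g, q, q.ne', q.not_gt, e1, e2, e3]

/-- A matrix of power series with constant term the identity matrix has one and only one block
Gauss factorization. -/
theorem existsUnique_gauss (b : ι → α) {M : Matrix ι ι R⟦X⟧}
    (hM : M.map PowerSeries.constantCoeff = 1) :
    ∃! P : Matrix ι ι R⟦X⟧ × Matrix ι ι R⟦X⟧ × Matrix ι ι R⟦X⟧,
      IsGaussFactorization b M P.1 P.2.1 P.2.2 := by
  have hN := vanishes_sub_one hM
  obtain ⟨g, hg, eg⟩ := exists_fixed b hN
  refine ⟨(1 + loPart b g, 1 + diPart b g, 1 + upPart b g), ?_, ?_⟩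
  · refine ⟨?_, ?_, ?_, ?_, ?_, ?_⟩
    · have e : M = 1 + g + crossTerms b g := by
        rw [← sub_eq_iff_eq_add, ← sub_eq_iff_eq_add', sub_right_comm, ← eg]
      have e' := parts_add b g
      rw [e]
      nth_rewrite 1 [← e']
      unfold crossTerms
      noncomm_ring
    · intro i j q
      simp [loPart, q.not_gt, Matrix.one_apply_ne (fun c => q.ne (c ▸ rfl) : i ≠ j)]
    · intro i j q; simp [loPart, q]
    · intro i j q
      simp [diPart, q, Matrix.one_apply_ne (fun c => q (c ▸ rfl) : i ≠ j)]
    · intro i j q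
      simp [upPart, q.not_gt, Matrix.one_apply_ne (fun c => q.ne' (c ▸ rfl) : i ≠ j)]
    · intro i j q; simp [upPart, q]
  · rintro ⟨F, D, E⟩ h
    have h0 := (h.map PowerSeries.constantCoeff)
    rw [hM] at h0
    obtain ⟨hF, hD, hE⟩ := h0.eq_one
    obtain ⟨pF, pD, pE⟩ := h.parts
    have hv := ((vanishes_sub_one hF).add (vanishes_sub_one hD)).add (vanishes_sub_one hE)
    have := fixed_unique b hg hv eg (by
      unfold crossTerms
      rw [pF, pD, pE, h.eq_mul]
      noncomm_ring)
    rw [this, pF, pD, pE]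
    simp

end Gauss

/-! ## Parabolic and Drinfeld generators -/

section Generators

variable (k : Type*) [CommRing k] {n : ℕ}

/-- The triple `(F(u), D(u), E(u))` of the Gauss factorization `T(u) = F(u) D(u) E(u)` of shape `μ`.
It exists and is unique by `existsUnique_gauss`. -/
def gaussFactors (μ : Composition n) :
    Matrix (Fin n) (Fin n) (Yangian k n)⟦X⟧ × Matrix (Fin n) (Fin n) (Yangian k n)⟦X⟧ ×
      Matrix (Fin n) (Fin n) (Yangian k n)⟦X⟧ :=
  (existsUnique_gauss μ.index (tMatrix_constantCoeff k n)).choose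

theorem gaussFactors_spec (μ : Composition n) :
    IsGaussFactorization μ.index (tMatrix k n) (gaussFactors k μ).1 (gaussFactors k μ).2.1
      (gaussFactors k μ).2.2 :=
  (existsUnique_gauss μ.index (tMatrix_constantCoeff k n)).choose_spec.1

/-- The matrix `D_a(u) = (D_{a;i,j}(u))`, the `a`-th diagonal block of `D(u)`. -/
def blockD (μ : Composition n) (a : Fin μ.length) :
    Matrix (Fin (μ.blocksFun a)) (Fin (μ.blocksFun a)) (Yangian k n)⟦X⟧ :=
  (gaussFactors k μ).2.1.submatrix (μ.embedding a) (μ.embedding a)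

/-- The diagonal Drinfeld series `d_i(u)`: the diagonal entries of `D(u)` for the shape
`(1, …, 1)`. -/
def drinfeldD (i : Fin n) : (Yangian k n)⟦X⟧ :=
  (gaussFactors k (Composition.ones n)).2.1 i i

end Generators

/-! ## Shifts of the parameter, quantum determinants, the Harish-Chandra series -/

section Series

variable {k : Type*} [CommRing k]

/-- The expansion `(u - c)⁻¹ = ∑_{r ≥ 0} c ^ r u^{-r-1}` as a series in `X = u⁻¹`. -/
def invSub (c : k) : k⟦X⟧ := PowerSeries.X * PowerSeries.mk fun r => c ^ r

/-- `invSub c` is indeed `(u - c)⁻¹ = u⁻¹ / (1 - c u⁻¹)`. -/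
theorem one_sub_mul_invSub (c : k) :
    (1 - PowerSeries.C c * PowerSeries.X) * invSub c = PowerSeries.X := by
  have h : (1 - PowerSeries.C c * PowerSeries.X) * (PowerSeries.mk fun r => c ^ r) = 1 := by
    rw [sub_mul, one_mul, mul_assoc]
    ext r
    cases r with
    | zero => simp
    | succ r => simp [PowerSeries.coeff_succ_X_mul, pow_succ', PowerSeries.coeff_one]
  rw [invSub, mul_left_comm, h, mul_one]

/-- The series `f(u - c) = ∑_r f_r (u - c)^{-r}`, re-expanded in `u⁻¹`. The coefficient of `u^{-s}`
only involves `f_r` for `r ≤ s`, because `(u - c)^{-r}` is divisible by `u^{-r}`. -/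
def shift {Y : Type*} [Ring Y] [Algebra k Y] (c : k) (f : Y⟦X⟧) : Y⟦X⟧ :=
  PowerSeries.mk fun s => ∑ r ∈ Finset.range (s + 1),
    PowerSeries.coeff s (invSub c ^ r) • PowerSeries.coeff r f

variable (k) in
/-- The quantum determinant
`∑_σ sgn(σ) A_{σ(1),1}(u) A_{σ(2),2}(u-1) ⋯ A_{σ(N),N}(u-N+1)`, the factors in this order. -/
def qdet {Y : Type*} [Ring Y] [Algebra k Y] {N : ℕ} (A : Matrix (Fin N) (Fin N) Y⟦X⟧) : Y⟦X⟧ :=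
  ∑ σ : Equiv.Perm (Fin N), (Equiv.Perm.sign σ : ℤ) •
    (List.ofFn fun j : Fin N => shift (j.val : k) (A (σ j) j)).prod

variable (k) in
/-- The Harish-Chandra series `c(u) = d_1(u) d_2(u-1) ⋯ d_n(u-n+1)`. -/
def hcSeries (n : ℕ) : (Yangian k n)⟦X⟧ :=
  (List.ofFn fun i : Fin n => shift (i.val : k) (drinfeldD k i)).prod

end Series

end

end ModularYangian

namespace ModularYangian

noncomputable section

open scoped TensorProduct

/-! Both sides equal the quantum determinant of T(u). Let τ be the operator f(u) ↦ f(u-1) on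
`Y_n[[u⁻¹]]`. The RTT relation, specialised at v = u-1, says that T(u)τ is a Manin matrix
(`isManin_shiftMatrix`), and pushing every τ to the right shows that the ordinary column determinant
of A(u)τ is qdet A(u) · τ^N (`colDet_shiftMatrix`). The shifts in the statement are thus absorbed
into noncommutativity.

If T = FDE, then Tτ = F(u) · D(u)τ · E(u+1) is again a Gauss factorization. For a Manin matrix M,
encode the columns as elements of Λ(V) ⊗ R; since 2 is invertible they anticommute and have square
zero, and their ordered product is the volume element tensored with the column determinant.
Subtracting right multiples of earlier columns from later ones does not change this product, so one
may clear the upper right block. This gives colDet M = colDet M₁₁ · colDet D₂₂ when the second block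
is the last one (`IsManin.colDet_eq_mul_of_gauss`).

Leading submatrices of T inherit the factorization. So the leading quantum determinants Q_r, which
do not depend on μ, satisfy Q_{m+l}(u) = Q_m(u) · qdet D_a(u-m) for a block on positions m+1, …, m+l
(`leadingQdet_add`); the shift by m comes from moving τ^m past the block. Telescoping for μ and for
(1, …, 1) gives the two products. -/

/-! ## Column determinants of Manin matrices -/

section Manin

variable {R : Type*} [Ring R]

/-- The column determinant `∑_σ sgn(σ) M_{σ(1),1} ⋯ M_{σ(N),N}`, the factors in this order. -/
def colDet {N : ℕ} (M : Matrix (Fin N) (Fin N) R) : R :=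
  ∑ σ : Equiv.Perm (Fin N), (Equiv.Perm.sign σ : ℤ) • (List.ofFn fun j => M (σ j) j).prod

/-- The cross commutation relations of a Manin matrix. -/
def IsManin {ι κ : Type*} (M : Matrix ι κ R) : Prop :=
  ∀ i h j l, M i j * M h l + M i l * M h j = M h j * M i l + M h l * M i j

theorem IsManin.submatrix {ι κ ι' κ' : Type*} {M : Matrix ι κ R} (hM : IsManin M) (f : ι' → ι)
    (g : κ' → κ) : IsManin (M.submatrix f g) := fun i h j l => hM (f i) (f h) (g j) (g l)

/-- The product of anticommuting elements of square zero, one of which is repeated, vanishes. -/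
theorem list_prod_mul_eq_zero {L : List R} (h : ∀ x ∈ L, ∀ y ∈ L, x * y = -(y * x))
    (h0 : ∀ x ∈ L, x * x = 0) {x : R} (hx : x ∈ L) : L.prod * x = 0 := by
  induction L with
  | nil => simp at hx
  | cons y L ih =>
    -- The left y travels through the list, changing signs, until it meets the right y, where y² =
    -- 0.
    have pass : ∀ L' : List R, (∀ z ∈ L', z * y = -(y * z)) → y * (L'.prod * y) = 0 := by
      intro L'
      induction L' with
      | nil => intro _; simpa using h0 y (by simp)
      | cons z L' ih' =>
        intro hz
        have e : y * z = -(z * y) := by rw [hz z (by simp), neg_neg]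
        rw [List.prod_cons, mul_assoc, ← mul_assoc, e, neg_mul, mul_assoc,
          ih' fun w hw => hz w (by simp [hw]), mul_zero, neg_zero]
    rw [List.prod_cons, mul_assoc]
    rcases List.mem_cons.1 hx with rfl | hx
    · exact pass L fun z hz => h z (by simp [hz]) x (by simp)
    · rw [ih (fun a ha b hb => h a (by simp [ha]) b (by simp [hb]))
        (fun a ha => h0 a (by simp [ha])) hx, mul_zero]

/-- In a product of anticommuting elements of square zero, right multiples of the first factors
may be subtracted from the last ones. -/
theorem prod_mul_prod_sub {m l : ℕ} (a : Fin m → R) (c : Fin l → R) (X : Fin m → Fin l → R)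
    (h : ∀ x ∈ List.ofFn a ++ List.ofFn c, ∀ y ∈ List.ofFn a ++ List.ofFn c, x * y = -(y * x))
    (h0 : ∀ x ∈ List.ofFn a ++ List.ofFn c, x * x = 0) :
    (List.ofFn a).prod * (List.ofFn fun j => c j - ∑ i, a i * X i j).prod
      = (List.ofFn a).prod * (List.ofFn c).prod := by
  induction l with
  | zero => simp
  | succ l ih =>
    have sub : ∀ x ∈ List.ofFn a ++ List.ofFn (fun j : Fin l => c j.castSucc),
        x ∈ List.ofFn a ++ List.ofFn c := by
      intro x hx
      simp only [List.mem_append, List.mem_ofFn] at hx ⊢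
      rcases hx with hx | ⟨j, rfl⟩
      · exact Or.inl hx
      · exact Or.inr ⟨_, rfl⟩
    have ih' := ih (fun j => c j.castSucc) (fun i j => X i j.castSucc)
      (fun x hx y hy => h x (sub x hx) y (sub y hy)) (fun x hx => h0 x (sub x hx))
    rw [List.ofFn_succ', List.ofFn_succ' c, List.concat_eq_append, List.concat_eq_append,
      List.prod_append, List.prod_append, List.prod_singleton, List.prod_singleton, ← mul_assoc,
      ← mul_assoc, ih', mul_sub, Finset.mul_sum, sub_eq_self]
    -- The earlier factors are already restored by induction, so the correction has the form
    -- (product containing `a i`) · `a i` · `X`. The first two pieces multiply to zero, and `X`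
    -- never has to be moved.
    refine Finset.sum_eq_zero fun i _ => ?_
    have := list_prod_mul_eq_zero (fun x hx y hy => h x (sub x hx) y (sub y hy))
      (fun x hx => h0 x (sub x hx)) (x := a i) (by simp)
    rw [List.prod_append] at this
    rw [← mul_assoc, this, zero_mul]

/-! ### Columns as elements of an exterior algebra -/

variable {k : Type*} [CommRing k] [Algebra k R] {V : Type*} [AddCommGroup V] [Module k V]

theorem prod_ofFn_tmul {A : Type*} [Ring A] [Algebra k A] {N : ℕ} (a : Fin N → A)
    (b : Fin N → R) : (List.ofFn fun j => a j ⊗ₜ[k] b j).prod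
      = (List.ofFn a).prod ⊗ₜ[k] (List.ofFn b).prod := by
  induction N with
  | zero => simp [Algebra.TensorProduct.one_def]
  | succ N ih => simp [List.ofFn_succ, ih, Algebra.TensorProduct.tmul_mul_tmul]

/-- The columns of `M`, with the rows indexed by the vectors `v i`. -/
def grassmannCol {κ : Type*} [Fintype κ] {η : Type*} (v : κ → V) (M : Matrix κ η R) (j : η) :
    ExteriorAlgebra k V ⊗[k] R :=
  ∑ i, ExteriorAlgebra.ι k (v i) ⊗ₜ[k] M i j

theorem prod_grassmannCol {κ : Type*} [Fintype κ] {N : ℕ} (v : κ → V) (M : Matrix κ (Fin N) R) :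
    (List.ofFn (grassmannCol (k := k) v M)).prod
      = ∑ f : Fin N → κ, ExteriorAlgebra.ιMulti k N (v ∘ f) ⊗ₜ[k]
          (List.ofFn fun j => M (f j) j).prod := by
  have e := (MultilinearMap.mkPiAlgebraFin k N (ExteriorAlgebra k V ⊗[k] R)).map_sum
    (fun (j : Fin N) (i : κ) => ExteriorAlgebra.ι k (v i) ⊗ₜ[k] M i j)
  simp only [MultilinearMap.mkPiAlgebraFin_apply, prod_ofFn_tmul] at e
  simp only [ExteriorAlgebra.ιMulti_apply]
  exact e

theorem sum_ιMulti_tmul {N : ℕ} (v : Fin N → V) (M : Matrix (Fin N) (Fin N) R) :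
    ∑ f : Fin N → Fin N, ExteriorAlgebra.ιMulti k N (v ∘ f) ⊗ₜ[k]
        (List.ofFn fun j => M (f j) j).prod
      = ExteriorAlgebra.ιMulti k N v ⊗ₜ[k] colDet M := by
  rw [colDet, TensorProduct.tmul_sum]
  symm
  -- Row choices that are not permutations repeat a vector and contribute zero; a permutation
  -- contributes its sign.
  refine Fintype.sum_of_injective (fun σ : Equiv.Perm (Fin N) => (σ : Fin N → Fin N))
    DFunLike.coe_injective _ _ (fun f hf => ?_) (fun σ => ?_)
  · rw [AlternatingMap.map_eq_zero_of_not_injective, TensorProduct.zero_tmul]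
    intro hi
    have : Function.Injective f := fun x y e => hi (congrArg v e)
    exact hf ⟨Equiv.ofBijective f (Finite.injective_iff_bijective.1 this), rfl⟩
  · rw [AlternatingMap.map_perm, TensorProduct.tmul_smul, ← TensorProduct.smul_tmul']
    rfl

theorem prod_grassmannCol_square {N : ℕ} (v : Fin N → V) (M : Matrix (Fin N) (Fin N) R) :
    (List.ofFn (grassmannCol (k := k) v M)).prod
      = ExteriorAlgebra.ιMulti k N v ⊗ₜ[k] colDet M := by
  rw [prod_grassmannCol, sum_ιMulti_tmul]

theorem eq_zero_of_eq_neg (h2 : IsUnit (2 : k)) {W : Type*} [AddCommGroup W] [Module k W] {w : W}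
    (h : w = -w) : w = 0 := by
  have : (2 : k) • w = 0 := by rw [two_smul]; nth_rewrite 2 [h]; simp
  exact h2.smul_eq_zero.1 this

/-- In the anticommutator, the coefficient of `v i ∧ v h` is symmetric in i and h by the Manin
relation, while the wedge is antisymmetric. Exchanging i and h therefore shows that the sum is its
own negative. -/
theorem grassmannCol_anticomm (h2 : IsUnit (2 : k)) {κ η : Type*} [Fintype κ] (v : κ → V)
    {M : Matrix κ η R} (hM : IsManin M) (j l : η) :
    grassmannCol (k := k) v M j * grassmannCol v M l
      = -(grassmannCol v M l * grassmannCol v M j) := by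
  rw [eq_neg_iff_add_eq_zero]
  have e : grassmannCol (k := k) v M j * grassmannCol v M l
      + grassmannCol v M l * grassmannCol v M j
      = ∑ i, ∑ h, (ExteriorAlgebra.ι k (v i) * ExteriorAlgebra.ι k (v h)) ⊗ₜ[k]
          (M i j * M h l + M i l * M h j) := by
    simp only [grassmannCol, Finset.sum_mul_sum, Algebra.TensorProduct.tmul_mul_tmul,
      TensorProduct.tmul_add, Finset.sum_add_distrib]
  rw [e]
  refine eq_zero_of_eq_neg h2 ?_
  conv_lhs => rw [Finset.sum_comm]
  simp only [← Finset.sum_neg_distrib]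
  refine Finset.sum_congr rfl fun i _ => Finset.sum_congr rfl fun h _ => ?_
  rw [hM h i j l, ← TensorProduct.neg_tmul,
    eq_neg_of_add_eq_zero_left (ExteriorAlgebra.ι_add_mul_swap (v h) (v i))]

theorem ιMulti_mul_ιMulti {m l : ℕ} (a : Fin m → V) (c : Fin l → V) :
    ExteriorAlgebra.ιMulti k m a * ExteriorAlgebra.ιMulti k l c
      = ExteriorAlgebra.ιMulti k (m + l) (Fin.append a c) := by
  simp only [ExteriorAlgebra.ιMulti_apply]
  rw [← List.prod_append, ← List.ofFn_fin_append]
  congr 2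
  ext i
  refine Fin.addCases (fun i => ?_) (fun i => ?_) i <;> simp

/-- The product of the first columns, multiplied by all the last basis vectors, only involves the
upper part of these columns. -/
theorem prod_grassmannCol_mul {m l : ℕ} (v : Fin (m + l) → V) (M : Matrix (Fin (m + l)) (Fin m) R)
    (x : R) :
    (List.ofFn (grassmannCol (k := k) v M)).prod
        * (ExteriorAlgebra.ιMulti k l (fun j => v (Fin.natAdd m j)) ⊗ₜ[k] x)
      = ExteriorAlgebra.ιMulti k (m + l) v ⊗ₜ[k]
          (colDet (M.submatrix (Fin.castAdd l) id) * x) := by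
  have e : ExteriorAlgebra.ιMulti k (m + l) v
      = ExteriorAlgebra.ιMulti k m (fun i => v (Fin.castAdd l i))
        * ExteriorAlgebra.ιMulti k l (fun j => v (Fin.natAdd m j)) := by
    rw [ιMulti_mul_ιMulti]
    congr 1
    ext i
    refine Fin.addCases (fun i => ?_) (fun i => ?_) i <;> simp
  rw [e, ← Algebra.TensorProduct.tmul_mul_tmul, ← sum_ιMulti_tmul, prod_grassmannCol,
    Finset.sum_mul, Finset.sum_mul]
  symm
  refine Fintype.sum_of_injective (fun (f : Fin m → Fin m) j => Fin.castAdd l (f j))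
    (fun f g h => funext fun j => Fin.castAdd_injective m l (congrFun h j)) _ _ (fun f hf => ?_)
    (fun f => rfl)
  -- A row choice that leaves the first m rows picks one of the last vectors, which already occurs
  -- in the second factor.
  have : ∃ j h, f j = Fin.natAdd m h := by
    by_contra! H
    have : ∀ j, ∃ i, f j = Fin.castAdd l i := fun j => by
      have := H j
      revert this
      exact Fin.addCases (motive := fun q => (∀ h, q ≠ Fin.natAdd m h) → ∃ i, q = Fin.castAdd l i)
        (fun i _ => ⟨i, rfl⟩) (fun i h => absurd rfl (h i)) (f j)
    choose g hg using this
    exact hf ⟨g, (funext hg).symm⟩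
  obtain ⟨j, h, hj⟩ := this
  rw [Algebra.TensorProduct.tmul_mul_tmul, ιMulti_mul_ιMulti,
    AlternatingMap.map_eq_zero_of_eq _ _ (i := Fin.castAdd l j) (j := Fin.natAdd m h) (by simp [hj])
      (fun q => by have := congrArg Fin.val q; simp at this; omega), TensorProduct.zero_tmul]

theorem tmul_ιMulti_injective (N : ℕ) :
    Function.Injective fun x : R =>
      ExteriorAlgebra.ιMulti k N (fun i : Fin N => (Pi.single i 1 : Fin N → k)) ⊗ₜ[k] x := by
  -- The functional that is the determinant in degree N and zero in all other degrees; it takes the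
  -- value 1 on the volume element, so lam ⊗ id recovers x.
  let lam : ExteriorAlgebra k (Fin N → k) →ₗ[k] k := ExteriorAlgebra.liftAlternating
    (Function.update 0 N Matrix.detRowAlternating)
  have hl : lam (ExteriorAlgebra.ιMulti k N (fun i : Fin N => (Pi.single i 1 : Fin N → k))) = 1 := by
    simp only [lam, ExteriorAlgebra.liftAlternating_apply_ιMulti, Function.update_self]
    have : (fun i : Fin N => (Pi.single i 1 : Fin N → k)) = (1 : Matrix (Fin N) (Fin N) k) := by
      ext i j; simp [Matrix.one_apply, Pi.single_apply, eq_comm]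
    rw [this]
    exact Matrix.det_one
  intro x y h
  have := congrArg (TensorProduct.lid k R ∘ lam.rTensor R) h
  simpa [hl] using this

/-- Subtracting right multiples of the first columns from the last ones so as to make the matrix
block lower triangular, one computes the column determinant of a Manin matrix blockwise. -/
theorem IsManin.colDet_eq_mul (h2 : IsUnit (2 : k)) {m l : ℕ} {M : Matrix (Fin (m + l)) (Fin (m + l)) R}
    (hM : IsManin M) (X : Matrix (Fin m) (Fin l) R) (S : Matrix (Fin l) (Fin l) R)
    (hu : ∀ i j, M (Fin.castAdd l i) (Fin.natAdd m j)
      = ∑ a, M (Fin.castAdd l i) (Fin.castAdd l a) * X a j)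
    (hl : ∀ i j, M (Fin.natAdd m i) (Fin.natAdd m j)
      = ∑ a, M (Fin.natAdd m i) (Fin.castAdd l a) * X a j + S i j) :
    colDet M = colDet (M.submatrix (Fin.castAdd l) (Fin.castAdd l)) * colDet S := by
  let v : Fin (m + l) → (Fin (m + l) → k) := fun i => Pi.single i 1
  let θ := grassmannCol (k := k) v M
  apply tmul_ιMulti_injective (k := k) (m + l)
  change ExteriorAlgebra.ιMulti k (m + l) v ⊗ₜ[k] _ = ExteriorAlgebra.ιMulti k (m + l) v ⊗ₜ[k] _
  have key := prod_grassmannCol_mul (k := k) v (M.submatrix id (Fin.castAdd l)) (colDet S)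
  rw [Matrix.submatrix_submatrix] at key
  refine Eq.trans ?_ key
  rw [← prod_grassmannCol_square, ← prod_grassmannCol_square]
  have hθ : ∀ j l, θ j * θ l = -(θ l * θ j) := grassmannCol_anticomm h2 v hM
  have mem : ∀ x ∈ (List.ofFn fun i => θ (Fin.castAdd l i)) ++ List.ofFn fun j => θ (Fin.natAdd m j),
      ∃ j, x = θ j := by
    intro x hx
    simp only [List.mem_append, List.mem_ofFn] at hx
    rcases hx with ⟨i, rfl⟩ | ⟨i, rfl⟩ <;> exact ⟨_, rfl⟩
  have sub := prod_mul_prod_sub (fun i => θ (Fin.castAdd l i)) (fun j => θ (Fin.natAdd m j))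
    (fun i j => (1 : ExteriorAlgebra k (Fin (m + l) → k)) ⊗ₜ[k] X i j)
    (fun x hx y hy => by
      obtain ⟨i, rfl⟩ := mem x hx
      obtain ⟨j, rfl⟩ := mem y hy
      exact hθ i j)
    (fun x hx => by
      obtain ⟨i, rfl⟩ := mem x hx
      exact eq_zero_of_eq_neg h2 (hθ i i))
  -- By `hu` the corrected last columns have zero upper part, and by `hl` their lower part is `S`.
  have col : (fun j => θ (Fin.natAdd m j)
        - ∑ i, θ (Fin.castAdd l i) * (1 : ExteriorAlgebra k (Fin (m + l) → k)) ⊗ₜ[k] X i j)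
      = grassmannCol (fun j => v (Fin.natAdd m j)) S := by
    ext1 j
    simp only [θ, grassmannCol, Finset.sum_mul, Algebra.TensorProduct.tmul_mul_tmul, mul_one]
    rw [Finset.sum_comm]
    simp only [← TensorProduct.tmul_sum]
    rw [← Finset.sum_sub_distrib, Fin.sum_univ_add]
    simp only [← TensorProduct.tmul_sub, hu, hl, sub_self, add_sub_cancel_left,
      Finset.sum_const_zero, zero_add]
  rw [col] at sub
  change (List.ofFn θ).prod = (List.ofFn fun i => θ (Fin.castAdd l i)).prod * _
  rw [sub, List.ofFn_add, List.prod_append]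
  rfl

/-! ### Gauss factorizations of Manin matrices -/

theorem isUnit_of_unitriangular {ι : Type*} [Fintype ι] [DecidableEq ι] (b : ι → ℕ) {E : Matrix ι ι R}
    (h0 : ∀ i j, b j < b i → E i j = 0) (h1 : ∀ i j, b i = b j → E i j = (1 : Matrix ι ι R) i j) :
    IsUnit E := by
  -- Each factor E - 1 raises the block number by at least one; as `b` is bounded, E - 1 is
  -- nilpotent.
  have key : ∀ r i j, b j < b i + r → ((E - 1) ^ r) i j = 0 := by
    intro r
    induction r with
    | zero => intro i j h; simp [Matrix.one_apply_ne (show i ≠ j by rintro rfl; omega)]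
    | succ r ih =>
      intro i j h
      rw [pow_succ, Matrix.mul_apply]
      refine Finset.sum_eq_zero fun q _ => ?_
      by_cases hq : b q < b i + r
      · rw [ih i q hq, zero_mul]
      · rcases lt_or_eq_of_le (show b j ≤ b q by omega) with hj | hj
        · rw [Matrix.sub_apply, h0 q j hj, Matrix.one_apply_ne (by rintro rfl; omega), sub_zero,
            mul_zero]
        · rw [Matrix.sub_apply, h1 q j hj.symm, sub_self, mul_zero]
  have nil : IsNilpotent (E - 1) := by
    refine ⟨Finset.univ.sup b + 1, ?_⟩
    ext i j
    exact key _ i j (by have := Finset.le_sup (f := b) (Finset.mem_univ j); omega)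
  simpa using nil.isUnit_one_add

/-- The omitted indices lie in strictly later blocks, where the retained rows of F and the retained
columns of E vanish, so truncation commutes with the products. -/
theorem IsGaussFactorization.submatrix {ι κ α : Type*} [Fintype ι] [DecidableEq ι] [Fintype κ]
    [DecidableEq κ] [LinearOrder α] {b : ι → α} {M F D E : Matrix ι ι R}
    (h : IsGaussFactorization b M F D E) (e : κ → ι) (he : Function.Injective e)
    (hb : ∀ i q, q ∉ Set.range e → b (e i) < b q) :
    IsGaussFactorization (b ∘ e) (M.submatrix e e) (F.submatrix e e) (D.submatrix e e)
      (E.submatrix e e) where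
  eq_mul := by
    have h1 : (F * D).submatrix e e = F.submatrix e e * D.submatrix e e := by
      ext i j
      rw [Matrix.submatrix_apply, Matrix.mul_apply, Matrix.mul_apply]
      symm
      exact Fintype.sum_of_injective e he _ _
        (fun q hq => by rw [h.lower_eq_zero _ _ (hb i q hq), zero_mul]) (fun _ => rfl)
    rw [← h1, h.eq_mul]
    ext i j
    rw [Matrix.submatrix_apply, Matrix.mul_apply, Matrix.mul_apply]
    symm
    exact Fintype.sum_of_injective e he _ _
      (fun q hq => by rw [h.upper_eq_zero _ _ (hb j q hq), mul_zero]) (fun _ => rfl)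
  lower_eq_zero i j q := h.lower_eq_zero _ _ q
  lower_diag i j q := by simp [h.lower_diag _ _ q, Matrix.one_apply, he.eq_iff]
  diag_eq_zero i j q := h.diag_eq_zero _ _ q
  upper_eq_zero i j q := h.upper_eq_zero _ _ q
  upper_diag i j q := by simp [h.upper_diag _ _ q, Matrix.one_apply, he.eq_iff]

/-- The column determinant of a Manin matrix in terms of a block Gauss factorization, the indices
of the last block being the last `l` ones. -/
theorem IsManin.colDet_eq_mul_of_gauss (h2 : IsUnit (2 : k)) {m l : ℕ} {b : Fin (m + l) → ℕ}
    {M F D E : Matrix (Fin (m + l)) (Fin (m + l)) R} (hM : IsManin M)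
    (h : IsGaussFactorization b M F D E) {β : ℕ} (hm : ∀ i, b (Fin.castAdd l i) < β)
    (hl : ∀ j, b (Fin.natAdd m j) = β) :
    colDet M = colDet (M.submatrix (Fin.castAdd l) (Fin.castAdd l))
      * colDet (D.submatrix (Fin.natAdd m) (Fin.natAdd m)) := by
  have lt : ∀ i j, b (Fin.castAdd l i) < b (Fin.natAdd m j) := fun i j => (hm i).trans_eq (hl j).symm
  -- The column operation is X = E₁₁⁻¹E₁₂. The first columns of M are (FD)₍·₁₎E₁₁ and the last are
  -- (FD)₍·₁₎E₁₂ + (FD)₍·₂₎, so subtracting the first times X leaves (FD)₍·₂₎. Its upper part is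
  -- zero, and its lower part is D₂₂ because F₂₂ = 1.
  obtain ⟨G, hG⟩ : ∃ G, E.submatrix (Fin.castAdd l) (Fin.castAdd l) * G = 1 := by
    refine (isUnit_of_unitriangular (b ∘ Fin.castAdd l) (fun i j q => h.upper_eq_zero _ _ q)
      fun i j q => ?_).exists_right_inv
    simp [h.upper_diag _ _ q, Matrix.one_apply]
  have hGX : E.submatrix (Fin.castAdd l) (Fin.castAdd l)
      * (G * E.submatrix (Fin.castAdd l) (Fin.natAdd m))
      = E.submatrix (Fin.castAdd l) (Fin.natAdd m) := by
    rw [← Matrix.mul_assoc, hG, Matrix.one_mul]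
  have hX : ∀ i j, ∑ a, M i (Fin.castAdd l a)
        * (G * E.submatrix (Fin.castAdd l) (Fin.natAdd m)) a j
      = ∑ c, (F * D) i (Fin.castAdd l c) * E (Fin.castAdd l c) (Fin.natAdd m j) := by
    intro i j
    have hMi : ∀ a, M i (Fin.castAdd l a)
        = ∑ c, (F * D) i (Fin.castAdd l c) * E (Fin.castAdd l c) (Fin.castAdd l a) := fun a => by
      rw [h.eq_mul, Matrix.mul_apply, Fin.sum_univ_add, add_eq_left]
      exact Finset.sum_eq_zero fun c _ => by rw [h.upper_eq_zero _ _ (lt a c), mul_zero]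
    simp only [hMi, Finset.sum_mul]
    rw [Finset.sum_comm]
    refine Finset.sum_congr rfl fun c _ => ?_
    simp only [mul_assoc, ← Finset.mul_sum]
    congr 1
    exact congrFun₂ hGX c j
  have hMj : ∀ i j, M i (Fin.natAdd m j)
      = ∑ c, (F * D) i (Fin.castAdd l c) * E (Fin.castAdd l c) (Fin.natAdd m j)
        + (F * D) i (Fin.natAdd m j) := fun i j => by
    rw [h.eq_mul, Matrix.mul_apply, Fin.sum_univ_add]
    congr 1
    rw [Finset.sum_eq_single j]
    · rw [h.upper_diag _ _ rfl, Matrix.one_apply_eq, mul_one]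
    · intro c _ hc
      rw [h.upper_diag _ _ ((hl c).trans (hl j).symm),
        Matrix.one_apply_ne (fun q => hc (Fin.natAdd_injective l m q)), mul_zero]
    · simp
  have hFD : ∀ i j, (F * D) i (Fin.natAdd m j)
      = ∑ c, F i (Fin.natAdd m c) * D (Fin.natAdd m c) (Fin.natAdd m j) := fun i j => by
    rw [Matrix.mul_apply, Fin.sum_univ_add, add_eq_right]
    exact Finset.sum_eq_zero fun c _ => by rw [h.diag_eq_zero _ _ (lt c j).ne, mul_zero]
  refine hM.colDet_eq_mul h2 (G * E.submatrix (Fin.castAdd l) (Fin.natAdd m)) _ (fun i j => ?_)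
    fun i j => ?_
  · rw [hX, hMj, add_eq_left, hFD]
    exact Finset.sum_eq_zero fun c _ => by rw [h.lower_eq_zero _ _ (lt i c), zero_mul]
  · rw [hX, hMj, add_right_inj, hFD, Finset.sum_eq_single i]
    · rw [h.lower_diag _ _ rfl, Matrix.one_apply_eq, one_mul, Matrix.submatrix_apply]
    · intro c _ hc
      rw [h.lower_diag _ _ ((hl i).trans (hl c).symm),
        Matrix.one_apply_ne (fun q => hc (Fin.natAdd_injective l m q.symm)), zero_mul]
    · simp

end Manin
/-! ## The shift automorphisms -/

section Shift

variable {k : Type*} [CommRing k] {Y : Type*} [Ring Y] [Algebra k Y]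

theorem coeff_X_pow_mul_invSub_pow (c : k) {r s N : ℕ} (h : N < r + s) :
    PowerSeries.coeff N (PowerSeries.X ^ r * invSub c ^ s) = 0 := by
  rw [invSub, mul_pow, ← mul_assoc, ← pow_add, PowerSeries.coeff_X_pow_mul', if_neg h.not_ge]

theorem coeff_invSub_pow (c : k) {s N : ℕ} (h : N < s) :
    PowerSeries.coeff N (invSub c ^ s) = 0 := by
  simpa using coeff_X_pow_mul_invSub_pow c (r := 0) (by simpa using h)

/-- In `shift`, the sum may be extended. -/
theorem coeff_shift (c : k) (f : Y⟦X⟧) {N K : ℕ} (h : N < K) :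
    PowerSeries.coeff N (shift c f) = ∑ r ∈ Finset.range K,
      PowerSeries.coeff N (invSub c ^ r) • PowerSeries.coeff r f := by
  rw [shift, PowerSeries.coeff_mk]
  refine Finset.sum_subset (fun r hr => ?_) fun r _ hr => ?_
  · simp only [Finset.mem_range] at hr ⊢; omega
  · rw [coeff_invSub_pow c (by simpa using hr), zero_smul]

theorem shift_add (c : k) (f g : Y⟦X⟧) : shift c (f + g) = shift c f + shift c g := by
  ext N
  simp [shift, Finset.sum_add_distrib]

theorem shift_smul (c x : k) (f : Y⟦X⟧) : shift c (x • f) = x • shift c f := by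
  ext N
  simp [shift, Finset.smul_sum, smul_comm x]

theorem shift_one (c : k) : shift c (1 : Y⟦X⟧) = 1 := by
  ext N
  rw [coeff_shift c 1 (Nat.lt_succ_self N), Finset.sum_eq_single 0]
  · by_cases h : N = 0 <;> simp [PowerSeries.coeff_one, h]
  · intro r _ hr; simp [PowerSeries.coeff_one, hr]
  · simp

theorem shift_mul (c : k) (f g : Y⟦X⟧) : shift c (f * g) = shift c f * shift c g := by
  ext N
  have hK : ∀ i ∈ Finset.HasAntidiagonal.antidiagonal N, i.1 < N + 1 ∧ i.2 < N + 1 := fun i hi => by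
    rw [Finset.HasAntidiagonal.mem_antidiagonal] at hi; omega
  have hr : PowerSeries.coeff N (shift c f * shift c g)
      = ∑ a ∈ Finset.range (N + 1), ∑ b ∈ Finset.range (N + 1),
        PowerSeries.coeff N (invSub c ^ (a + b)) •
          (PowerSeries.coeff a f * PowerSeries.coeff b g) := by
    rw [PowerSeries.coeff_mul]
    simp only [pow_add, PowerSeries.coeff_mul, Finset.sum_smul]
    rw [Finset.sum_congr rfl fun i hi => by
      rw [coeff_shift c f (hK i hi).1, coeff_shift c g (hK i hi).2, Finset.sum_mul_sum]]
    rw [Finset.sum_comm]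
    refine Finset.sum_congr rfl fun a _ => ?_
    rw [Finset.sum_comm]
    refine Finset.sum_congr rfl fun b _ => Finset.sum_congr rfl fun i _ => ?_
    rw [smul_mul_smul_comm]
  have hl : PowerSeries.coeff N (shift c (f * g))
      = ∑ r ∈ Finset.range (N + 1), ∑ i ∈ Finset.HasAntidiagonal.antidiagonal r,
        PowerSeries.coeff N (invSub c ^ (i.1 + i.2)) •
          (PowerSeries.coeff i.1 f * PowerSeries.coeff i.2 g) := by
    rw [coeff_shift c _ (Nat.lt_succ_self N)]
    refine Finset.sum_congr rfl fun r _ => ?_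
    rw [PowerSeries.coeff_mul, Finset.smul_sum]
    refine Finset.sum_congr rfl fun i hi => ?_
    rw [Finset.HasAntidiagonal.mem_antidiagonal.1 hi]
  -- The two sums have the same terms, over the triangle a + b ≤ N and over a square; outside the
  -- triangle (u-c)^{-(a+b)} has no term of degree N.
  rw [hl, hr, Finset.sum_sigma', ← Finset.sum_product']
  refine Finset.sum_of_injOn (fun x => x.2) ?_ ?_ ?_ ?_
  · rintro ⟨r, a⟩ hx ⟨r', a'⟩ hx' h
    simp only [Finset.coe_sigma, Set.mem_sigma_iff, Finset.mem_coe, Finset.HasAntidiagonal.mem_antidiagonal] at hx hx' h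
    subst h
    obtain rfl : r = r' := by omega
    rfl
  · rintro ⟨r, a⟩ hx
    simp only [Finset.coe_sigma, Set.mem_sigma_iff, Finset.mem_coe, Finset.HasAntidiagonal.mem_antidiagonal,
      Finset.mem_range, Finset.coe_product, Set.mem_prod] at hx ⊢
    omega
  · rintro ⟨a, b⟩ _ hx
    rw [coeff_invSub_pow, zero_smul]
    by_contra! h
    refine hx ⟨⟨a + b, (a, b)⟩, ?_, rfl⟩
    simp only [Finset.coe_sigma, Set.mem_sigma_iff, Finset.mem_coe, Finset.HasAntidiagonal.mem_antidiagonal,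
      Finset.mem_range, and_true]
    dsimp only at h
    omega
  · rintro x _
    rfl

theorem shift_pow (c : k) (f : Y⟦X⟧) (r : ℕ) : shift c (f ^ r) = shift c f ^ r := by
  induction r with
  | zero => simp [shift_one]
  | succ r ih => rw [pow_succ, pow_succ, shift_mul, ih]

theorem shift_X (c : k) : shift c (PowerSeries.X : k⟦X⟧) = invSub c := by
  ext N
  rw [coeff_shift c _ (show N < N + 2 by omega), Finset.sum_eq_single 1]
  · simp
  · intro r _ hr; simp [PowerSeries.coeff_X, hr]
  · simp

/-- Applying the shift to the equation (1 - dX) · `invSub d` = X and clearing the denominator 1 - cX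
gives the equation that characterises `invSub (c + d)`, since 1 - (c+d)X is a unit. -/
theorem shift_invSub (c d : k) : shift c (invSub d) = invSub (c + d) := by
  have h1 := congrArg (shift c) (one_sub_mul_invSub d)
  have e : (1 - PowerSeries.C d * PowerSeries.X : k⟦X⟧) = 1 + (-d) • PowerSeries.X := by
    rw [PowerSeries.smul_eq_C_mul, map_neg]; ring
  rw [e, shift_mul, shift_add, shift_one, shift_smul, shift_X, PowerSeries.smul_eq_C_mul, map_neg] at h1
  have hc := one_sub_mul_invSub c
  have hcd := one_sub_mul_invSub (c + d)
  have h2 : (1 - PowerSeries.C (c + d) * PowerSeries.X) * shift c (invSub d) = PowerSeries.X := by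
    rw [map_add]
    linear_combination (1 - PowerSeries.C c * PowerSeries.X) * h1
      + (1 + PowerSeries.C d * shift c (invSub d)) * hc
  have hu : IsUnit (1 - PowerSeries.C (c + d) * PowerSeries.X : k⟦X⟧) := by
    rw [PowerSeries.isUnit_iff_constantCoeff]; simp
  exact hu.mul_left_cancel (h2.trans hcd.symm)

theorem shift_shift (c d : k) (f : Y⟦X⟧) : shift c (shift d f) = shift (c + d) f := by
  ext N
  rw [coeff_shift c _ (Nat.lt_succ_self N), coeff_shift (c + d) _ (Nat.lt_succ_self N)]
  rw [Finset.sum_congr rfl fun r hr => by rw [coeff_shift d f (Finset.mem_range.1 hr),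
    Finset.smul_sum]]
  rw [Finset.sum_comm]
  refine Finset.sum_congr rfl fun q _ => ?_
  rw [← shift_invSub, ← shift_pow, coeff_shift c _ (Nat.lt_succ_self N), Finset.sum_smul]
  exact Finset.sum_congr rfl fun r _ => by rw [smul_eq_mul, mul_smul]

theorem shift_zero (f : Y⟦X⟧) : shift (0 : k) f = f := by
  ext N
  rw [coeff_shift (0 : k) f (Nat.lt_succ_self N), Finset.sum_eq_single N]
  all_goals
    have e : invSub (0 : k) = PowerSeries.X := by simpa using one_sub_mul_invSub (0 : k)
    simp +contextual [e, PowerSeries.coeff_X_pow, eq_comm]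

/-! ### Absorbing the shifts into operators -/

/-- Shifting by `c`, as an operator. -/
def shiftEnd (Y : Type*) [Ring Y] [Algebra k Y] (c : k) : Module.End k Y⟦X⟧ where
  toFun := shift c
  map_add' := shift_add c
  map_smul' := shift_smul c

@[simp] theorem shiftEnd_apply (c : k) (f : Y⟦X⟧) : shiftEnd Y c f = shift c f := rfl

theorem shiftEnd_mul (c d : k) : shiftEnd Y c * shiftEnd Y d = shiftEnd Y (c + d) :=
  LinearMap.ext fun f => shift_shift c d f

theorem shiftEnd_zero : shiftEnd Y (0 : k) = 1 := LinearMap.ext shift_zero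

theorem shiftEnd_mul_lmul (c : k) (f : Y⟦X⟧) :
    shiftEnd Y c * Algebra.lmul k Y⟦X⟧ f = Algebra.lmul k Y⟦X⟧ (shift c f) * shiftEnd Y c :=
  LinearMap.ext fun g => shift_mul c f g

/-- Moving all shift operators to the right shifts the j-th factor once for each operator on its
left, as in the definition of `qdet`. -/
theorem prod_lmul_mul_shiftEnd {N : ℕ} (f : Fin N → Y⟦X⟧) :
    (List.ofFn fun j => Algebra.lmul k Y⟦X⟧ (f j) * shiftEnd Y (1 : k)).prod
      = Algebra.lmul k Y⟦X⟧ (List.ofFn fun j => shift (j.val : k) (f j)).prod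
        * shiftEnd Y (N : k) := by
  induction N with
  | zero => simp only [List.ofFn_zero, List.prod_nil, Nat.cast_zero, shiftEnd_zero, map_one, mul_one]
  | succ N ih =>
    rw [List.ofFn_succ', List.ofFn_succ' (f := fun j : Fin (N + 1) => shift (j.val : k) (f j)),
      List.concat_eq_append, List.concat_eq_append, List.prod_append, List.prod_append,
      List.prod_singleton, List.prod_singleton, ih, mul_assoc, ← mul_assoc (shiftEnd Y (N : k)),
      shiftEnd_mul_lmul, mul_assoc, shiftEnd_mul, map_mul, mul_assoc]
    simp

/-- The matrix `A(u)` multiplied by the shift operator. -/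
def shiftMatrix (k : Type*) [CommRing k] [Algebra k Y] {ι κ : Type*} (A : Matrix ι κ Y⟦X⟧) :
    Matrix ι κ (Module.End k Y⟦X⟧) :=
  Matrix.of fun i j => Algebra.lmul k Y⟦X⟧ (A i j) * shiftEnd Y (1 : k)

theorem colDet_shiftMatrix {N : ℕ} (A : Matrix (Fin N) (Fin N) Y⟦X⟧) :
    colDet (shiftMatrix k A) = Algebra.lmul k Y⟦X⟧ (qdet k A) * shiftEnd Y (N : k) := by
  simp only [colDet, qdet, shiftMatrix, Matrix.of_apply, prod_lmul_mul_shiftEnd, map_sum,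
    map_zsmul, Finset.sum_mul, smul_mul_assoc]

/-- Moving τ leftwards past E(u) turns it into E(u+1), so τ can be attached to D, and both outer
factors remain unitriangular. -/
theorem IsGaussFactorization.shiftMatrix {ι α : Type*} [Fintype ι] [DecidableEq ι] [LinearOrder α]
    {b : ι → α} {M F D E : Matrix ι ι Y⟦X⟧} (h : IsGaussFactorization b M F D E) :
    IsGaussFactorization b (shiftMatrix k M) (F.map (Algebra.lmul k Y⟦X⟧))
      (ModularYangian.shiftMatrix k D)
      (E.map fun f => Algebra.lmul k Y⟦X⟧ (shift (-1 : k) f)) where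
  eq_mul := by
    ext1 i j
    have e : ∀ f g : Y⟦X⟧, Algebra.lmul k Y⟦X⟧ f * shiftEnd Y (1 : k)
        * Algebra.lmul k Y⟦X⟧ (shift (-1 : k) g)
        = Algebra.lmul k Y⟦X⟧ (f * g) * shiftEnd Y (1 : k) := fun f g => by
      rw [mul_assoc, shiftEnd_mul_lmul, shift_shift, add_neg_cancel, shift_zero, map_mul, mul_assoc]
    simp only [h.eq_mul, ModularYangian.shiftMatrix, Matrix.mul_apply, Matrix.of_apply,
      Matrix.map_apply, ← mul_assoc, ← map_mul, ← Finset.sum_mul, ← map_sum, e]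
  lower_eq_zero i j q := by simp [h.lower_eq_zero i j q]
  lower_diag i j q := by
    simp only [h.lower_diag i j q, Matrix.map_apply, Matrix.one_apply, apply_ite (Algebra.lmul k Y⟦X⟧),
      map_one, map_zero]
  diag_eq_zero i j q := by simp [ModularYangian.shiftMatrix, h.diag_eq_zero i j q]
  upper_eq_zero i j q := by
    have : shift (-1 : k) (0 : Y⟦X⟧) = 0 := (shiftEnd Y (-1 : k)).map_zero
    simp [h.upper_eq_zero i j q, this]
  upper_diag i j q := by
    have : shift (-1 : k) (0 : Y⟦X⟧) = 0 := (shiftEnd Y (-1 : k)).map_zero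
    simp only [h.upper_diag i j q, Matrix.map_apply, Matrix.one_apply, apply_ite (shift (-1 : k)),
      apply_ite (Algebra.lmul k Y⟦X⟧), shift_one, this, map_one, map_zero]

/-! ### Specialising two-variable relations at v = u - 1 -/

theorem sum_antidiagonal_coeff_invSub {W : Type*} [AddCommGroup W] [Module k W] (c : k)
    (f : ℕ → ℕ → W) (N : ℕ) :
    ∑ i ∈ Finset.HasAntidiagonal.antidiagonal N, ∑ s ∈ Finset.range (N + 1),
        PowerSeries.coeff i.2 (invSub c ^ s) • f i.1 s
      = ∑ r ∈ Finset.range (N + 1), ∑ s ∈ Finset.range (N + 1),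
        PowerSeries.coeff N (PowerSeries.X ^ r * invSub c ^ s) • f r s := by
  rw [Finset.Nat.sum_antidiagonal_eq_sum_range_succ_mk]
  refine Finset.sum_congr rfl fun r hr => Finset.sum_congr rfl fun s _ => ?_
  rw [PowerSeries.coeff_X_pow_mul', if_pos (by simpa [Nat.lt_succ_iff] using hr)]

/-- The coefficients of `f(u) g(u - c)`. -/
theorem coeff_mul_shift (c : k) (f g : Y⟦X⟧) (N : ℕ) :
    PowerSeries.coeff N (f * shift c g)
      = ∑ r ∈ Finset.range (N + 1), ∑ s ∈ Finset.range (N + 1),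
        PowerSeries.coeff N (PowerSeries.X ^ r * invSub c ^ s) •
          (PowerSeries.coeff r f * PowerSeries.coeff s g) := by
  rw [← sum_antidiagonal_coeff_invSub, PowerSeries.coeff_mul]
  refine Finset.sum_congr rfl fun i hi => ?_
  rw [Finset.HasAntidiagonal.mem_antidiagonal] at hi
  rw [coeff_shift c g (show i.2 < N + 1 by omega), Finset.mul_sum]
  exact Finset.sum_congr rfl fun s _ => mul_smul_comm _ _ _

/-- The coefficients of `g(u - c) f(u)`. -/
theorem coeff_shift_mul (c : k) (f g : Y⟦X⟧) (N : ℕ) :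
    PowerSeries.coeff N (shift c g * f)
      = ∑ r ∈ Finset.range (N + 1), ∑ s ∈ Finset.range (N + 1),
        PowerSeries.coeff N (PowerSeries.X ^ r * invSub c ^ s) •
          (PowerSeries.coeff s g * PowerSeries.coeff r f) := by
  rw [← sum_antidiagonal_coeff_invSub (f := fun r s => PowerSeries.coeff s g * PowerSeries.coeff r f),
    PowerSeries.coeff_mul, ← Finset.Nat.sum_antidiagonal_swap]
  refine Finset.sum_congr rfl fun i hi => ?_
  rw [Finset.HasAntidiagonal.mem_antidiagonal] at hi
  rw [Prod.fst_swap, Prod.snd_swap, coeff_shift c g (show i.2 < N + 1 by omega), Finset.sum_mul]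
  exact Finset.sum_congr rfl fun s _ => smul_mul_assoc _ _ _

theorem sum_range_eq_sum_shifted {W : Type*} [AddCommMonoid W] (φ : ℕ → W) {N : ℕ} (h0 : φ 0 = 0)
    (hN : φ (N + 1) = 0) :
    ∑ s ∈ Finset.range (N + 1), φ s = ∑ s ∈ Finset.range (N + 1), φ (s + 1) := by
  have h1 := Finset.sum_range_succ φ (N + 1)
  have h2 := Finset.sum_range_succ' φ (N + 1)
  rw [hN, add_zero] at h1
  rw [h0, add_zero] at h2
  rw [← h1, h2]

/-- If `F(u, v) = ∑ f_{r,s} u^{-r} v^{-s}` has no terms with `r = 0` or `s = 0`, then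
`(u - v) F(u, v)` and `F(u, v)` agree at `v = u - 1`. -/
theorem sum_coeff_smul_sub {W : Type*} [AddCommGroup W] [Module k W] (f : ℕ → ℕ → W)
    (h1 : ∀ r, f r 0 = 0) (h2 : ∀ s, f 0 s = 0) (N : ℕ) :
    ∑ r ∈ Finset.range (N + 1), ∑ s ∈ Finset.range (N + 1),
        PowerSeries.coeff N (PowerSeries.X ^ r * invSub (1 : k) ^ s) • (f (r + 1) s - f r (s + 1))
      = ∑ r ∈ Finset.range (N + 1), ∑ s ∈ Finset.range (N + 1),
        PowerSeries.coeff N (PowerSeries.X ^ r * invSub (1 : k) ^ s) • f r s := by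
  set w : ℕ → ℕ → k := fun r s => PowerSeries.coeff N (PowerSeries.X ^ r * invSub (1 : k) ^ s)
    with hw
  have w0 : ∀ r s, N < r + s → w r s = 0 := fun r s h => coeff_X_pow_mul_invSub_pow 1 h
  -- With X = u⁻¹ and `invSub 1` = v⁻¹, this is v⁻¹ - u⁻¹ = u⁻¹v⁻¹, that is, u - v = 1.
  have hy : invSub (1 : k) - PowerSeries.X = PowerSeries.X * invSub (1 : k) := by
    have := one_sub_mul_invSub (1 : k)
    rw [map_one] at this
    linear_combination this
  have w1 : ∀ r s, w (r + 1) (s + 1) = w r (s + 1) - w (r + 1) s := fun r s => by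
    simp only [hw]
    rw [← map_sub]
    congr 1
    linear_combination -(PowerSeries.X ^ r * invSub (1 : k) ^ s) * hy
  change ∑ r ∈ Finset.range (N + 1), ∑ s ∈ Finset.range (N + 1), w r s • (f (r + 1) s - f r (s + 1))
    = ∑ r ∈ Finset.range (N + 1), ∑ s ∈ Finset.range (N + 1), w r s • f r s
  simp only [smul_sub, Finset.sum_sub_distrib]
  -- All three sums are reindexed to the terms `f (r + 1) (s + 1)`, where `w1` compares the weights.
  -- The boundary terms vanish by `h1` and `h2` at index 0, and at N + 1 because the weight has
  -- order greater than N.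
  have e1 : ∑ r ∈ Finset.range (N + 1), ∑ s ∈ Finset.range (N + 1), w r s • f (r + 1) s
      = ∑ r ∈ Finset.range (N + 1), ∑ s ∈ Finset.range (N + 1), w r (s + 1) • f (r + 1) (s + 1) :=
    Finset.sum_congr rfl fun r _ => sum_range_eq_sum_shifted (fun s => w r s • f (r + 1) s)
      (by simp [h1]) (by simp [w0 r (N + 1) (by omega)])
  have e2 : ∑ r ∈ Finset.range (N + 1), ∑ s ∈ Finset.range (N + 1), w r s • f r (s + 1)
      = ∑ r ∈ Finset.range (N + 1), ∑ s ∈ Finset.range (N + 1), w (r + 1) s • f (r + 1) (s + 1) :=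
    sum_range_eq_sum_shifted (fun r => ∑ s ∈ Finset.range (N + 1), w r s • f r (s + 1))
      (by simp [h2]) (Finset.sum_eq_zero fun s _ => by rw [w0 (N + 1) s (by omega), zero_smul])
  have e3 : ∑ r ∈ Finset.range (N + 1), ∑ s ∈ Finset.range (N + 1), w r s • f r s
      = ∑ r ∈ Finset.range (N + 1), ∑ s ∈ Finset.range (N + 1),
        w (r + 1) (s + 1) • f (r + 1) (s + 1) := by
    refine (sum_range_eq_sum_shifted (fun r => ∑ s ∈ Finset.range (N + 1), w r s • f r s)
      (by simp [h2]) (Finset.sum_eq_zero fun s _ => by rw [w0 (N + 1) s (by omega), zero_smul])).trans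
      (Finset.sum_congr rfl fun r _ => sum_range_eq_sum_shifted (fun s => w (r + 1) s • f (r + 1) s)
      (by simp [h1]) (by simp [w0 (r + 1) (N + 1) (by omega)]))
  rw [e1, e2, e3]
  simp only [w1, sub_smul, Finset.sum_sub_distrib]

/-- From `(u - v) [f(u), g(v)] = a(u) c(v) - a(v) c(u)` to the case `v = u - 1`. -/
theorem commutator_shift_one {f g a c : Y⟦X⟧} (hf : ∀ s, Commute (PowerSeries.coeff 0 f) (PowerSeries.coeff s g))
    (hg : ∀ r, Commute (PowerSeries.coeff r f) (PowerSeries.coeff 0 g))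
    (h : ∀ r s, (PowerSeries.coeff (r + 1) f * PowerSeries.coeff s g
          - PowerSeries.coeff s g * PowerSeries.coeff (r + 1) f)
        - (PowerSeries.coeff r f * PowerSeries.coeff (s + 1) g
          - PowerSeries.coeff (s + 1) g * PowerSeries.coeff r f)
      = PowerSeries.coeff r a * PowerSeries.coeff s c
        - PowerSeries.coeff s a * PowerSeries.coeff r c) :
    f * shift (1 : k) g - shift (1 : k) g * f = a * shift (1 : k) c - shift (1 : k) a * c := by
  ext N
  have key := sum_coeff_smul_sub (k := k) (fun r s => PowerSeries.coeff r f * PowerSeries.coeff s g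
    - PowerSeries.coeff s g * PowerSeries.coeff r f) (fun r => sub_eq_zero.2 (hg r))
    (fun s => sub_eq_zero.2 (hf s)) N
  simp only [h] at key
  simp only [map_sub, coeff_mul_shift, coeff_shift_mul, ← Finset.sum_sub_distrib, ← smul_sub]
  exact key.symm

end Shift
/-! ## Quantum determinants of the Yangian -/

section Yangian

variable (k : Type*) [CommRing k] (n : ℕ)

theorem tGen_zero (i j : Fin n) : tGen k n i j 0 = if i = j then 1 else 0 := by
  rw [tGen, freeT]; split_ifs <;> simp

/-- The relation persists for r = 0 or s = 0: a scalar commutes with everything and the sum is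
empty. -/
theorem tGen_rtt (i j h l : Fin n) (r s : ℕ) :
    tGen k n i j r * tGen k n h l s - tGen k n h l s * tGen k n i j r
      = ∑ t ∈ Finset.range (min r s), (tGen k n h j t * tGen k n i l (r + s - 1 - t)
          - tGen k n h j (r + s - 1 - t) * tGen k n i l t) := by
  rcases Nat.eq_zero_or_pos r with rfl | hr
  · rw [tGen_zero]; split_ifs <;> simp
  rcases Nat.eq_zero_or_pos s with rfl | hs
  · rw [tGen_zero]; split_ifs <;> simp
  have := RingQuot.mkAlgHom_rel k (RTTRel.rtt (k := k) i j h l r s hr hs)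
  simp only [map_sub, map_mul, map_sum] at this
  exact this

/-- The relation `(u - v) [t_{i,j}(u), t_{h,l}(v)] = t_{h,j}(u) t_{i,l}(v) - t_{h,j}(v) t_{i,l}(u)`. -/
theorem tGen_rtt_succ (i j h l : Fin n) (r s : ℕ) :
    (tGen k n i j (r + 1) * tGen k n h l s - tGen k n h l s * tGen k n i j (r + 1))
        - (tGen k n i j r * tGen k n h l (s + 1) - tGen k n h l (s + 1) * tGen k n i j r)
      = tGen k n h j r * tGen k n i l s - tGen k n h j s * tGen k n i l r := by
  rw [tGen_rtt, tGen_rtt, show r + 1 + s - 1 = r + s by omega, show r + (s + 1) - 1 = r + s by omega]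
  -- Both sums have the same summands, of total degree r + s. Their ranges differ by the single
  -- index min(r, s), or not at all if r = s.
  rcases lt_trichotomy r s with q | q | q
  · rw [show min (r + 1) s = r + 1 by omega, show min r (s + 1) = r by omega,
      Finset.sum_range_succ, add_sub_cancel_left, show r + s - r = s by omega]
  · subst q
    rw [show min (r + 1) r = r by omega, show min r (r + 1) = r by omega, sub_self, sub_self]
  · rw [show min (r + 1) s = s by omega, show min r (s + 1) = s + 1 by omega,
      Finset.sum_range_succ, show r + s - s = r by omega]
    abel

/-- The defining relation at `v = u - 1`. -/
theorem tMatrix_commutator (i j h l : Fin n) :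
    tMatrix k n i j * shift (1 : k) (tMatrix k n h l)
        - shift (1 : k) (tMatrix k n h l) * tMatrix k n i j
      = tMatrix k n h j * shift (1 : k) (tMatrix k n i l)
        - shift (1 : k) (tMatrix k n h j) * tMatrix k n i l := by
  have c0 : ∀ (i j h l : Fin n) (s : ℕ), Commute (tGen k n i j 0) (tGen k n h l s) :=
    fun i j h l s => by rw [tGen_zero]; split_ifs <;> simp
  refine commutator_shift_one (fun s => ?_) (fun r => ?_) fun r s => ?_
  · simpa [tMatrix] using c0 i j h l s
  · simpa [tMatrix] using (c0 h l i j r).symm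
  · simpa [tMatrix] using tGen_rtt_succ k n i j h l r s

/-- `T(u)` times the shift operator is a Manin matrix. -/
theorem isManin_shiftMatrix : IsManin (shiftMatrix k (tMatrix k n)) := by
  intro i h j l
  have e : ∀ f g : (Yangian k n)⟦X⟧,
      Algebra.lmul k _ f * shiftEnd _ (1 : k) * (Algebra.lmul k _ g * shiftEnd _ (1 : k))
        = Algebra.lmul k _ (f * shift (1 : k) g) * (shiftEnd _ (1 : k) * shiftEnd _ (1 : k)) :=
    fun f g => by
      rw [mul_assoc, ← mul_assoc (shiftEnd _ (1 : k)), shiftEnd_mul_lmul, map_mul]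
      simp only [mul_assoc]
  simp only [shiftMatrix, Matrix.of_apply, e, ← add_mul, ← map_add]
  congr 2
  -- Adding the relation with j and l exchanged cancels the products whose left factor is the
  -- shifted one; what remains is the Manin relation.
  have h1 := tMatrix_commutator k n i j h l
  have h2 := tMatrix_commutator k n i l h j
  rw [sub_eq_iff_eq_add] at h1 h2
  rw [h1, h2]
  abel

/-- The quantum determinant of the leading submatrix of `T(u)` of size `r`. -/
def leadingQdet (r : ℕ) (hr : r ≤ n) : (Yangian k n)⟦X⟧ :=
  qdet k ((tMatrix k n).submatrix (Fin.castLE hr) (Fin.castLE hr))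

theorem leadingQdet_zero : leadingQdet k n 0 (Nat.zero_le n) = 1 := by
  simp [leadingQdet, qdet]

variable {k n}

theorem leadingQdet_congr {r s : ℕ} (h : r = s) (hr : r ≤ n) :
    leadingQdet k n r hr = leadingQdet k n s (h ▸ hr) := by
  subst h; rfl

/-- After truncation to the first m + l indices, the block β is the last one, so the Manin
factorization reads Q_{m+l}τ^{m+l} = Q_m τ^m · qdet D · τ^l. Moving τ^m to the right shifts qdet D
by m. -/
theorem leadingQdet_add (h2 : IsUnit (2 : k)) {b : Fin n → ℕ}
    {F D E : Matrix (Fin n) (Fin n) (Yangian k n)⟦X⟧}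
    (h : IsGaussFactorization b (tMatrix k n) F D E) {m l : ℕ} (hml : m + l ≤ n) {β : ℕ}
    (h_lt : ∀ i : Fin n, i.val < m → b i < β)
    (h_eq : ∀ i : Fin n, m ≤ i.val → i.val < m + l → b i = β)
    (h_gt : ∀ i : Fin n, m + l ≤ i.val → β < b i) :
    leadingQdet k n (m + l) hml = leadingQdet k n m ((Nat.le_add_right m l).trans hml)
      * shift (m : k) (qdet k (D.submatrix (fun j : Fin l => Fin.castLE hml (Fin.natAdd m j))
          fun j : Fin l => Fin.castLE hml (Fin.natAdd m j))) := by
  have hg := (h.shiftMatrix (k := k)).submatrix (Fin.castLE hml) (Fin.castLE_injective hml)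
    (fun i q hq => by
      have hq' : m + l ≤ q.val := by
        by_contra! hlt
        exact hq ⟨⟨q, hlt⟩, rfl⟩
      have := h_gt q hq'
      by_cases hi : i.val < m
      · exact (h_lt _ hi).trans this
      · rwa [h_eq (Fin.castLE hml i) (not_lt.1 hi) i.2])
  have key := ((isManin_shiftMatrix k n).submatrix (Fin.castLE hml)
    (Fin.castLE hml)).colDet_eq_mul_of_gauss h2 hg (β := β)
    (fun i => h_lt _ i.2) (fun j => h_eq _ (Nat.le_add_right m j) (by simp))
  have key' : colDet (shiftMatrix k ((tMatrix k n).submatrix (Fin.castLE hml) (Fin.castLE hml)))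
      = colDet (shiftMatrix k ((tMatrix k n).submatrix
          (Fin.castLE ((Nat.le_add_right m l).trans hml))
          (Fin.castLE ((Nat.le_add_right m l).trans hml))))
        * colDet (shiftMatrix k (D.submatrix (fun j : Fin l => Fin.castLE hml (Fin.natAdd m j))
          fun j : Fin l => Fin.castLE hml (Fin.natAdd m j))) := key
  rw [colDet_shiftMatrix, colDet_shiftMatrix, colDet_shiftMatrix, mul_assoc,
    ← mul_assoc (shiftEnd _ (m : k)), shiftEnd_mul_lmul] at key'
  -- The series 1 is fixed by every shift, so evaluating at it removes the operators.
  have := LinearMap.congr_fun key' 1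
  simpa [shift_one, leadingQdet] using this

/-! ### Telescoping along a composition -/

theorem IsGaussFactorization.comp_strictMono {ι α γ R : Type*} [Fintype ι] [DecidableEq ι]
    [LinearOrder α] [LinearOrder γ] [Ring R] {b : ι → α} {M F D E : Matrix ι ι R}
    (h : IsGaussFactorization b M F D E) {f : α → γ} (hf : StrictMono f) :
    IsGaussFactorization (f ∘ b) M F D E where
  eq_mul := h.eq_mul
  lower_eq_zero i j q := h.lower_eq_zero i j (hf.lt_iff_lt.1 q)
  lower_diag i j q := h.lower_diag i j (hf.injective q)
  diag_eq_zero i j q := h.diag_eq_zero i j fun e => q (congrArg f e)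
  upper_eq_zero i j q := h.upper_eq_zero i j (hf.lt_iff_lt.1 q)
  upper_diag i j q := h.upper_diag i j (hf.injective q)

theorem lt_sizeUpTo_iff_index (μ : Composition n) (i : Fin n) (a : ℕ) :
    i.val < μ.sizeUpTo a ↔ (μ.index i).val < a := by
  constructor
  · intro h
    by_contra! q
    exact absurd (h.trans_le ((μ.monotone_sizeUpTo q).trans (μ.sizeUpTo_index_le i))) (lt_irrefl _)
  · intro h
    exact (μ.lt_sizeUpTo_index_succ i).trans_le (μ.monotone_sizeUpTo h)

theorem leadingQdet_sizeUpTo_succ (h2 : IsUnit (2 : k)) (μ : Composition n) (a : Fin μ.length) :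
    leadingQdet k n (μ.sizeUpTo (a + 1)) (μ.sizeUpTo_le _)
      = leadingQdet k n (μ.sizeUpTo a) (μ.sizeUpTo_le _)
        * shift (μ.sizeUpTo a : k) (qdet k (blockD k μ a)) := by
  have e := μ.sizeUpTo_succ' a
  have hml : μ.sizeUpTo a + μ.blocksFun a ≤ n := e ▸ μ.sizeUpTo_le _
  have key := leadingQdet_add h2
    ((gaussFactors_spec k μ).comp_strictMono (f := Fin.val) fun _ _ q => q) hml (β := a)
    (fun i hi => (lt_sizeUpTo_iff_index μ i a).1 hi)
    (fun i h1 h2 => by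
      rw [← e, lt_sizeUpTo_iff_index] at h2
      rw [← not_lt, lt_sizeUpTo_iff_index] at h1
      simp only [Function.comp_apply]
      omega)
    (fun i h1 => by
      rw [← e, ← not_lt, lt_sizeUpTo_iff_index] at h1
      simp only [Function.comp_apply]
      omega)
  exact (leadingQdet_congr e _).trans key

theorem leadingQdet_ones_succ (h2 : IsUnit (2 : k)) (a : Fin n) :
    leadingQdet k n (a + 1) a.2 = leadingQdet k n a a.2.le * shift (a : k) (drinfeldD k a) := by
  have hb : ∀ i : Fin n, ((Composition.ones n).index i).val = i.val := fun i => by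
    have h := fun a => lt_sizeUpTo_iff_index (Composition.ones n) i a
    simp only [Composition.ones_sizeUpTo, lt_min_iff, i.2, and_true] at h
    have h1 := h i.val
    have h3 := h (i.val + 1)
    omega
  have key := leadingQdet_add h2
    ((gaussFactors_spec k (Composition.ones n)).comp_strictMono (f := Fin.val) fun _ _ q => q)
    (m := a) (l := 1) a.2 (β := a)
    (fun i hi => by simpa [hb] using hi)
    (fun i h1 h2 => by simp only [Function.comp_apply, hb]; omega)
    (fun i h1 => by simp only [Function.comp_apply, hb]; omega)
  rw [key]
  congr 2
  simp [qdet, shift_zero, drinfeldD]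
  rfl

theorem eq_prod_ofFn {R : Type*} [Monoid R] {N : ℕ} (Q : ℕ → R) (f : Fin N → R) (h0 : Q 0 = 1)
    (hs : ∀ a : Fin N, Q (a + 1) = Q a * f a) : Q N = (List.ofFn f).prod := by
  induction N with
  | zero => simpa using h0
  | succ N ih =>
    rw [List.ofFn_succ', List.concat_eq_append, List.prod_append, List.prod_singleton,
      ← ih (fun a => f a.castSucc) fun a => hs a.castSucc]
    exact hs (Fin.last N)

theorem qdet_tMatrix_eq_prod_blockD (h2 : IsUnit (2 : k)) (μ : Composition n) :
    qdet k (tMatrix k n) = (List.ofFn fun a : Fin μ.length =>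
      shift (μ.sizeUpTo a : k) (qdet k (blockD k μ a))).prod := by
  rw [← eq_prod_ofFn (fun a => leadingQdet k n (μ.sizeUpTo a) (μ.sizeUpTo_le a)) _
    ((leadingQdet_congr μ.sizeUpTo_zero _).trans (leadingQdet_zero k n))
    (leadingQdet_sizeUpTo_succ h2 μ)]
  exact (leadingQdet_congr μ.sizeUpTo_length _).symm

theorem qdet_tMatrix_eq_hcSeries (h2 : IsUnit (2 : k)) : qdet k (tMatrix k n) = hcSeries k n := by
  -- The telescoping sequence must be defined on all of ℕ, hence the truncation `min a n`, which is
  -- inactive for a ≤ n.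
  rw [hcSeries, ← eq_prod_ofFn (fun a => leadingQdet k n (min a n) (min_le_right a n)) _
    ((leadingQdet_congr (Nat.zero_min n) _).trans (leadingQdet_zero k n)) fun a => ?_]
  · exact (leadingQdet_congr (min_self n) _).symm
  · refine (leadingQdet_congr (min_eq_left (show a.val + 1 ≤ n from a.2)) _).trans ?_
    rw [leadingQdet_ones_succ h2 a]
    congr 1
    exact (leadingQdet_congr (min_eq_left a.2.le) _).symm

end Yangian

end

end ModularYangian

theorem mainTheorem9 {p : ℕ} [Fact p.Prime] (hp : 2 < p)
    {k : Type*} [Field k] [IsAlgClosed k] [CharP k p]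
    (n : ℕ) (μ : Composition n) :
    ModularYangian.hcSeries k n =
      (List.ofFn fun a : Fin μ.length =>
        ModularYangian.shift (μ.sizeUpTo a : k)
          (ModularYangian.qdet k (ModularYangian.blockD k μ a))).prod := by
  have h2 : IsUnit (2 : k) := by
    refine IsUnit.mk0 _ fun h => ?_
    have : ((2 : ℕ) : k) = 0 := by exact_mod_cast h
    exact absurd (Nat.le_of_dvd two_pos ((CharP.cast_eq_zero_iff k p 2).1 this)) hp.not_ge
  rw [← ModularYangian.qdet_tMatrix_eq_hcSeries h2,
    ModularYangian.qdet_tMatrix_eq_prod_blockD h2 μ]
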